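/- Let $T$ be a complete first-order theory in a countable language whose set $S(T)$ of complete types in finitely many variables over $\varnothing$ has cardinality $2^{\omega}$. Let $\bar x$ be a finite tuple of variables and let $X$ be an uncountable set of complete types $p(\bar x)$ of $T$ with the uniform choice property: for every finite tuple $\bar y$ of variables and every formula $\varphi(\bar x,\bar y)$ there is a formula $\psi(\bar x,\bar y)$, not depending on $p$, such that for every $p\in X$ and every realization $\bar a$ of $p$ in a model of $T$, if $\varphi(\bar a,\bar y)$ is consistent, then $\psi(\bar a,\bar y)$ is a principal formula (that is, it is consistent and isolates a complete type over $\bar a$) and $\psi(\bar a,\bar y)\vdash\varphi(\bar a,\bar y)$. Then $P(T)=2^{\omega}$, where $P(T)$ is the number of isomorphism types of countable models of $T$ that are prime over some finite tuple of their elements. -/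

import Mathlib

universe u v w

open FirstOrder FirstOrder.Language Cardinal

namespace UnsmallTheory

variable {L : FirstOrder.Language.{u, v}}

/-- The class of unsmall theories: countable (that is, in a countable language) complete
theories whose set `S(T)` of complete types in finitely many variables over the empty set
has the cardinality of the continuum. -/
structure IsUnsmall (T : L.Theory) : Prop where
  countable : L.card ≤ ℵ₀
  complete : T.IsComplete
  card_types : #(Σ n : ℕ, T.CompleteType (Fin n)) = 𝔠

section Formulas

variable {M : Type w} [L.Structure M] {n m : ℕ}

/-- The formula `φ(a, y)` with parameters `a` from `M` is consistent (with `Th(M, a)`). -/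
def ConsistentOver (a : Fin n → M) (φ : L.Formula (Fin n ⊕ Fin m)) : Prop :=
  ∃ b : Fin m → M, φ.Realize (Sum.elim a b)

/-- `ψ(a, y) ⊢ φ(a, y)` (modulo `Th(M, a)`). -/
def ImpliesOver (a : Fin n → M) (ψ φ : L.Formula (Fin n ⊕ Fin m)) : Prop :=
  ∀ b : Fin m → M, ψ.Realize (Sum.elim a b) → φ.Realize (Sum.elim a b)

/-- `ψ(a, y)` is a principal formula: it is consistent, and it isolates a complete type
over `a`, i.e. it implies every formula `θ(a, y)` or its negation. -/
def PrincipalOver (a : Fin n → M) (ψ : L.Formula (Fin n ⊕ Fin m)) : Prop :=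
  ConsistentOver a ψ ∧
    ∀ θ : L.Formula (Fin n ⊕ Fin m), ImpliesOver a ψ θ ∨ ImpliesOver a ψ θ.not

/-- The structure `M` is prime over its tuple `a`: it embeds elementarily, over `a`, into every
structure `N` with a tuple `b` that satisfies the same formulas as `a` (equivalently, `(M, a)`
embeds elementarily into every model of `Th(M, a)`). -/
def IsPrimeOver (L : FirstOrder.Language.{u, v}) {M : Type w} [L.Structure M] {n : ℕ}
    (a : Fin n → M) : Prop :=
  ∀ (N : Type w) [L.Structure N] (b : Fin n → N),
    (∀ φ : L.Formula (Fin n), φ.Realize a ↔ φ.Realize b) →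
      ∃ f : M ↪ₑ[L] N, ∀ i, f (a i) = b i

end Formulas

/-- The uniform choice property of a set `X` of complete `n`-types: for every formula `φ(x, y)`
there is a formula `ψ(x, y)`, the same for all `p ∈ X`, such that whenever `a` realizes
some `p ∈ X` and `φ(a, y)` is consistent, `ψ(a, y)` is principal and `ψ(a, y) ⊢ φ(a, y)`. -/
def UniformChoice (T : L.Theory) {n : ℕ} (X : Set (T.CompleteType (Fin n))) : Prop :=
  ∀ (m : ℕ) (φ : L.Formula (Fin n ⊕ Fin m)), ∃ ψ : L.Formula (Fin n ⊕ Fin m),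
    ∀ p ∈ X, ∀ (M : Theory.ModelType.{u, v, 0} T) (a : Fin n → M), T.typeOf a = p →
      ConsistentOver a φ → PrincipalOver a ψ ∧ ImpliesOver a ψ φ

/-- Isomorphism of models of `T`. -/
def isoSetoid (T : L.Theory) : Setoid (Theory.ModelType.{u, v, 0} T) where
  r M N := Nonempty (M ≃[L] N)
  iseqv :=
    { refl := fun M => ⟨FirstOrder.Language.Equiv.refl L M⟩
      symm := fun ⟨f⟩ => ⟨f.symm⟩
      trans := fun ⟨f⟩ ⟨g⟩ => ⟨g.comp f⟩ }

/-- The set `P(T)` of isomorphism types of countable models of `T` that are prime over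
some finite tuple of their elements. -/
def primeModels (T : L.Theory) : Set (Quotient (isoSetoid T)) :=
  {c | ∃ M : Theory.ModelType.{u, v, 0} T, Quotient.mk (isoSetoid T) M = c ∧ Countable M ∧
    ∃ (n : ℕ) (a : Fin n → M), IsPrimeOver L a}

end UnsmallTheory

/-!
Whether `ψ(a, y)` is a correct choice for `φ(a, y)` is a set of first-order conditions on `a`, so
uniform choice passes from `X` to its closure in the Stone space. This closure is an uncountable
closed subset of a Polish space and therefore has cardinality `𝔠`.

If `a` realizes a type in the closure, then uniform choice makes the isolated types over `a` dense,
and a Henkin construction inside a model containing `a` yields a countable elementary substructure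
all of whose finite tuples are isolated over `a`; such a structure is prime over `a`. Hence every
type in the closure is realized in a model counted by `P(T)`. A countable model realizes only
countably many types, so `𝔠 ≤ P(T) · ℵ₀` and thus `𝔠 ≤ P(T)`.
-/

namespace UnsmallTheory

theorem exists_seq_of_forall_exists_snoc {M : Type*} (P : ∀ k, (Fin k → M) → Prop)
    (D : ∀ k, (Fin k → M) → Set M) (zero : P 0 Fin.elim0)
    (succ : ∀ k f, P k f → ∃ z ∈ D k f, P (k + 1) (Fin.snoc f z)) :
    ∃ c : ℕ → M, ∀ k, P k (fun i : Fin k ↦ c i) ∧ c k ∈ D k (fun i : Fin k ↦ c i) := by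
  have : Nonempty M := ⟨(succ 0 _ zero).choose⟩
  choose! g hgD hgP using succ
  let s : ∀ k, Fin k → M := Nat.rec Fin.elim0 fun k f ↦ Fin.snoc f (g k f)
  have s_succ (k : ℕ) : s (k + 1) = Fin.snoc (s k) (g k (s k)) := rfl
  have s_eq (k : ℕ) : s k = fun i : Fin k ↦ g i (s i) := by
    induction k with
    | zero => exact funext fun i ↦ i.elim0
    | succ k ih =>
      funext i
      cases i using Fin.lastCases with
      | last => simp [s_succ]
      | cast i => simpa [s_succ] using congrFun ih i
  have hsP (k : ℕ) : P k (s k) := by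
    induction k with
    | zero => exact zero
    | succ k ih => exact hgP k _ ih
  refine ⟨fun k ↦ g k (s k), fun k ↦ ?_⟩
  rw [← s_eq k]
  exact ⟨hsP k, hgD k _ (hsP k)⟩

theorem continuum_le_mk_of_countable_cover {α ι : Type*} {C : Set α} (hC : 𝔠 ≤ #C)
    {R : ι → Set α} (hR : ∀ i, (R i).Countable) (hCR : C ⊆ ⋃ i, R i) : 𝔠 ≤ #ι := by
  by_contra! hι
  have hunion : lift #C ≤ lift #ι * ℵ₀ :=
    calc
      lift #C ≤ lift #(⋃ i, R i) := lift_le.2 (mk_le_mk_of_subset hCR)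
      _ ≤ lift #ι * ⨆ i, lift #(R i) := mk_iUnion_le_lift R
      _ ≤ lift #ι * ℵ₀ := by
        gcongr
        exact ciSup_le' fun i ↦ lift_le_aleph0.2 (hR i).le_aleph0
  have hlt : lift #ι * ℵ₀ < 𝔠 :=
    mul_lt_of_lt aleph0_le_continuum (lift_lt_continuum.2 hι) aleph0_lt_continuum
  exact (hunion.trans_lt hlt).not_ge (continuum_le_lift.2 hC)

section SameType

variable {L : FirstOrder.Language.{u, v}} {M N K : Type*} [L.Structure M] [L.Structure N]
  [L.Structure K] {α β : Type*}

/-- The tuples `v` and `w`, possibly in different structures, have the same complete type over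
`∅`. Unlike equality of `FirstOrder.Language.Theory.typeOf`, this refers to no theory `T`. -/
def SameType (L : FirstOrder.Language.{u, v}) {M N : Type*} [L.Structure M] [L.Structure N]
    {α : Type*} (v : α → M) (w : α → N) : Prop :=
  ∀ φ : L.Formula α, φ.Realize v ↔ φ.Realize w

theorem SameType.symm {v : α → M} {w : α → N} (h : SameType L v w) : SameType L w v :=
  fun φ ↦ (h φ).symm

theorem SameType.trans {v : α → M} {w : α → N} {x : α → K} (h₁ : SameType L v w)
    (h₂ : SameType L w x) : SameType L v x :=
  fun φ ↦ (h₁ φ).trans (h₂ φ)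

theorem SameType.comp {v : α → M} {w : α → N} (h : SameType L v w) (g : β → α) :
    SameType L (v ∘ g) (w ∘ g) := fun φ ↦ by
  simpa only [Formula.realize_relabel] using h (φ.relabel g)

theorem sameType_of_forall_imp {v : α → M} {w : α → N}
    (h : ∀ φ : L.Formula α, φ.Realize v → φ.Realize w) : SameType L v w :=
  fun φ ↦ ⟨h φ, fun hw ↦ by_contra fun hv ↦ h φ.not hv hw⟩

theorem sameType_of_forall_finset {v : α → M} {w : α → N}
    (h : ∀ s : Finset α, SameType L (fun i : s ↦ v i) fun i : s ↦ w i) : SameType L v w := by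
  classical
  intro φ
  have hv : Formula.Realize (BoundedFormula.restrictFreeVar φ id)
      (fun i : φ.freeVarFinset ↦ v i) ↔ φ.Realize v :=
    BoundedFormula.realize_restrictFreeVar v fun _ ↦ rfl
  have hw : Formula.Realize (BoundedFormula.restrictFreeVar φ id)
      (fun i : φ.freeVarFinset ↦ w i) ↔ φ.Realize w :=
    BoundedFormula.realize_restrictFreeVar w fun _ ↦ rfl
  exact hv.symm.trans ((h _ _).trans hw)

theorem exists_forall_inr_mem_lt (s : Finset (α ⊕ ℕ)) :
    ∃ k, ∀ i, Sum.inr i ∈ s → i < k := by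
  obtain ⟨k, hk⟩ := (s.preimage Sum.inr Sum.inr_injective.injOn).bddAbove
  exact ⟨k + 1, fun i hi ↦ Nat.lt_succ_of_le (hk (by simpa using hi))⟩

theorem sameType_sumElim_of_forall_initial {a : α → M} {c : ℕ → M} {b : α → N} {d : ℕ → N}
    (h : ∀ k, SameType L (Sum.elim a fun i : Fin k ↦ c i) (Sum.elim b fun i : Fin k ↦ d i)) :
    SameType L (Sum.elim a c) (Sum.elim b d) := by
  refine sameType_of_forall_finset fun s ↦ ?_
  obtain ⟨k, hk⟩ := exists_forall_inr_mem_lt s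
  let g : s → α ⊕ Fin k
    | ⟨Sum.inl i, _⟩ => Sum.inl i
    | ⟨Sum.inr i, hi⟩ => Sum.inr ⟨i, hk i hi⟩
  convert (h k).comp g using 1 <;> funext ⟨i, _⟩ <;> cases i <;> rfl

theorem sameType_comp_elementaryEmbedding (f : M ↪ₑ[L] N) (v : α → M) :
    SameType L (f ∘ v) v :=
  fun φ ↦ f.map_formula φ v

theorem SameType.exists_elementaryEmbedding {v : α → M} {w : α → N} (h : SameType L v w)
    (hv : Function.Surjective v) : ∃ f : M ↪ₑ[L] N, f ∘ v = w := by
  have eq_of_eq (i j : α) (hij : v i = v j) : w i = w j := by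
    simpa using (h (Term.equal (Term.var i) (Term.var j))).1 (by simpa using hij)
  let r := Function.surjInv hv
  have hr : v ∘ r = id := funext (Function.surjInv_eq hv)
  refine ⟨⟨w ∘ r, fun m φ x ↦ ?_⟩, funext fun i ↦ eq_of_eq _ _ (Function.surjInv_eq hv _)⟩
  have hφ := h.comp (r ∘ x) φ
  rw [← Function.comp_assoc, ← Function.comp_assoc, hr, Function.id_comp] at hφ
  exact hφ.symm

theorem SameType.nonempty_equiv {v : α → M} {w : α → N} (h : SameType L v w)
    (hv : Function.Surjective v) (hw : Function.Surjective w) : Nonempty (M ≃[L] N) := by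
  obtain ⟨f, rfl⟩ := h.exists_elementaryEmbedding hv
  exact ⟨{ _root_.Equiv.ofBijective f ⟨f.injective, hw.of_comp⟩ with
    map_fun' := f.map_fun
    map_rel' := f.map_rel }⟩

theorem typeOf_eq_typeOf_iff {T : L.Theory} [Nonempty M] [M ⊨ T] [Nonempty N] [N ⊨ T]
    {v : α → M} {w : α → N} : T.typeOf v = T.typeOf w ↔ SameType L v w := by
  refine ⟨fun h φ ↦ ?_, fun h ↦ SetLike.ext fun φ ↦ ?_⟩
  · rw [← Theory.CompleteType.formula_mem_typeOf (T := T), h,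
      Theory.CompleteType.formula_mem_typeOf]
  · rw [Theory.CompleteType.mem_typeOf, Theory.CompleteType.mem_typeOf, h]

theorem realizedTypes_subset_of_elementaryEmbedding {T : L.Theory} [Nonempty M] [M ⊨ T]
    [Nonempty N] [N ⊨ T] (f : M ↪ₑ[L] N) : T.realizedTypes M α ⊆ T.realizedTypes N α := by
  rintro _ ⟨v, rfl⟩
  exact ⟨f ∘ v, typeOf_eq_typeOf_iff.2 (sameType_comp_elementaryEmbedding f v)⟩

end SameType

section Definable

variable {L : FirstOrder.Language.{u, v}} {M : Type*} [L.Structure M] {α : Type*}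

/-- The formula `∃ z, φ(x, y, z)` obtained by quantifying the last variable of `φ(x, y, z)`. -/
def existsLast {k : ℕ} (φ : L.Formula (α ⊕ Fin (k + 1))) : L.Formula (α ⊕ Fin k) :=
  (BoundedFormula.relabel (β := α) (n := k + 1) id φ).ex.toFormula

theorem realize_existsLast {k : ℕ} {φ : L.Formula (α ⊕ Fin (k + 1))} {a : α → M}
    {b : Fin k → M} : (existsLast φ).Realize (Sum.elim a b) ↔
      ∃ z, φ.Realize (Sum.elim a (Fin.snoc b z)) := by
  rw [existsLast, BoundedFormula.realize_toFormula, BoundedFormula.realize_ex]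
  refine exists_congr fun z ↦ ?_
  rw [Formula.Realize, BoundedFormula.realize_relabel]
  simp [Unique.eq_default]

theorem exists_formula_of_definable₁_range {v : α → M} {D : Set M}
    (hD : (Set.range v).Definable₁ L D) :
    ∃ φ : L.Formula (α ⊕ Fin 1), ∀ z, z ∈ D ↔ φ.Realize (Sum.elim v fun _ ↦ z) := by
  obtain ⟨φ, hφ⟩ := Set.definable_iff_exists_formula_sum.1 hD
  choose r hr using fun s : Set.range v ↦ s.2
  refine ⟨φ.relabel (Sum.map r id), fun z ↦ ?_⟩
  have : Sum.elim v (fun _ : Fin 1 ↦ z) ∘ Sum.map r id =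
      Sum.elim (fun s : Set.range v ↦ (s : M)) fun _ ↦ z := by
    rw [Sum.elim_comp_map, Function.comp_id]
    exact congrArg₂ Sum.elim (funext hr) rfl
  rw [Formula.realize_relabel, this]
  exact Set.ext_iff.1 hφ fun _ ↦ z

theorem exists_formula_snoc_of_definable₁ {k : ℕ} {a : α → M} {b : Fin k → M} {D : Set M}
    (hD : (Set.range (Sum.elim a b)).Definable₁ L D) :
    ∃ φ : L.Formula (α ⊕ Fin (k + 1)), ∀ z, z ∈ D ↔ φ.Realize (Sum.elim a (Fin.snoc b z)) := by
  obtain ⟨φ, hφ⟩ := exists_formula_of_definable₁_range hD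
  refine ⟨φ.relabel (Sum.elim (Sum.map id Fin.castSucc) fun _ ↦ Sum.inr (Fin.last k)),
    fun z ↦ ?_⟩
  rw [hφ, Formula.realize_relabel]
  congr! 1
  ext ((i | i) | i) <;> simp

theorem countable_setOf_definable₁ [Countable L.Symbols] {A : Set M} (hA : A.Countable) :
    {D : Set M | A.Definable₁ L D}.Countable := by
  have := hA.to_subtype
  refine (Set.countable_range fun φ : L[[A]].Formula (Fin 1) ↦
    {z : M | φ.Realize fun _ ↦ z}).mono ?_
  rintro D ⟨φ, hφ⟩
  exact ⟨φ, Set.ext fun z ↦ (Set.ext_iff.1 hφ fun _ ↦ z).symm⟩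

theorem exists_definable_initial {a : α → M} {c : ℕ → M} {β : Type*} {D : Set (β → M)}
    (hD : (Set.range (Sum.elim a c)).Definable L D) :
    ∃ k, (Set.range (Sum.elim a fun i : Fin k ↦ c i)).Definable L D := by
  classical
  obtain ⟨A, hA, hD⟩ := Set.definable_iff_finitely_definable.1 hD
  choose r hr using fun s : A ↦ hA s.2
  obtain ⟨k, hk⟩ := exists_forall_inr_mem_lt (Finset.univ.image r)
  refine ⟨k, hD.mono fun x hx ↦ ?_⟩
  have hrx : r ⟨x, hx⟩ ∈ Finset.univ.image r := Finset.mem_image_of_mem r (Finset.mem_univ _)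
  have hxr := hr ⟨x, hx⟩
  cases h : r ⟨x, hx⟩ with
  | inl i => exact ⟨Sum.inl i, by simpa [h] using hxr⟩
  | inr i => exact ⟨Sum.inr ⟨i, hk i (h ▸ hrx)⟩, by simpa [h] using hxr⟩

end Definable

section Isolated

variable {L : FirstOrder.Language.{u, v}} {M : Type*} [L.Structure M] {n : ℕ} {a : Fin n → M}

/-- The isolated types over `a` are dense: every consistent formula over `a` is implied by a
principal one. -/
def DenselyIsolatedOver (L : FirstOrder.Language.{u, v}) {M : Type*} [L.Structure M] {n : ℕ}
    (a : Fin n → M) : Prop :=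
  ∀ (m : ℕ) (φ : L.Formula (Fin n ⊕ Fin m)), ConsistentOver a φ →
    ∃ ψ : L.Formula (Fin n ⊕ Fin m), PrincipalOver a ψ ∧ ImpliesOver a ψ φ

/-- The complete type of the tuple `b` over `a` is isolated by a single formula. -/
def IsolatedOver (L : FirstOrder.Language.{u, v}) {M : Type*} [L.Structure M] {n m : ℕ}
    (a : Fin n → M) (b : Fin m → M) : Prop :=
  ∃ χ : L.Formula (Fin n ⊕ Fin m), PrincipalOver a χ ∧ χ.Realize (Sum.elim a b)

theorem PrincipalOver.impliesOver {m : ℕ} {χ θ : L.Formula (Fin n ⊕ Fin m)}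
    (hχ : PrincipalOver a χ) {b : Fin m → M} (hb : χ.Realize (Sum.elim a b))
    (hθ : θ.Realize (Sum.elim a b)) : ImpliesOver a χ θ :=
  (hχ.2 θ).resolve_right fun hn ↦ hn b hb hθ

theorem PrincipalOver.sameType {N : Type*} [L.Structure N] {m : ℕ} {b : Fin n → N}
    (hab : SameType L a b) {χ : L.Formula (Fin n ⊕ Fin m)} (hχ : PrincipalOver a χ)
    {x : Fin m → M} {y : Fin m → N} (hx : χ.Realize (Sum.elim a x))
    (hy : χ.Realize (Sum.elim b y)) : SameType L (Sum.elim a x) (Sum.elim b y) := by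
  refine sameType_of_forall_imp fun θ hθ ↦ ?_
  have implies_a : ((χ.imp θ).iAlls (Fin m)).Realize a :=
    Formula.realize_iAlls.2 fun w ↦ Formula.realize_imp.2 (hχ.impliesOver hx hθ w)
  have implies_b := Formula.realize_iAlls.1 ((hab _).1 implies_a) y
  exact Formula.realize_imp.1 implies_b hy

theorem DenselyIsolatedOver.isolatedOver_elim0 (ha : DenselyIsolatedOver L a) :
    IsolatedOver L a Fin.elim0 := by
  obtain ⟨ψ, hψ, -⟩ := ha 0 ⊤ ⟨Fin.elim0, Formula.realize_top.2 trivial⟩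
  obtain ⟨w, hw⟩ := hψ.1
  exact ⟨ψ, hψ, Subsingleton.elim w Fin.elim0 ▸ hw⟩

theorem IsolatedOver.exists_mem_snoc (ha : DenselyIsolatedOver L a) {k : ℕ} {b : Fin k → M}
    (hb : IsolatedOver L a b) {D : Set M} (hD : D.Nonempty)
    (hdef : (Set.range (Sum.elim a b)).Definable₁ L D) :
    ∃ z ∈ D, IsolatedOver L a (Fin.snoc b z : Fin (k + 1) → M) := by
  obtain ⟨χ, hχ, hχb⟩ := hb
  obtain ⟨φ, hφ⟩ := exists_formula_snoc_of_definable₁ hdef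
  obtain ⟨z, hz⟩ := hD
  let χ' : L.Formula (Fin n ⊕ Fin (k + 1)) := χ.relabel (Sum.map id Fin.castSucc)
  have realize_χ' (w : Fin k → M) (x : M) :
      χ'.Realize (Sum.elim a (Fin.snoc w x)) ↔ χ.Realize (Sum.elim a w) := by
    have hinit : (Fin.snoc w x : Fin (k + 1) → M) ∘ Fin.castSucc = w := Fin.init_snoc _ _
    rw [Formula.realize_relabel, Sum.elim_comp_map, Function.comp_id, hinit]
  obtain ⟨ψ, hψ, hψφ⟩ := ha (k + 1) (χ' ⊓ φ)
    ⟨Fin.snoc b z, Formula.realize_inf.2 ⟨(realize_χ' b z).2 hχb, (hφ z).1 hz⟩⟩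
  have hχψ : ImpliesOver a χ (existsLast ψ) := by
    obtain ⟨w, hw⟩ := hψ.1
    rw [← Fin.snoc_init_self w] at hw
    exact hχ.impliesOver ((realize_χ' _ _).1 (Formula.realize_inf.1 (hψφ _ hw)).1)
      (realize_existsLast.2 ⟨_, hw⟩)
  obtain ⟨y, hy⟩ := realize_existsLast.1 (hχψ b hχb)
  exact ⟨y, (hφ y).2 (Formula.realize_inf.1 (hψφ _ hy)).2, ψ, hψ, hy⟩

/-- Henkin construction: stage `Nat.pair i j` picks a point of the `i`-th nonempty set definable
over `a` and the first `j` points. -/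
theorem DenselyIsolatedOver.exists_seq_isolatedOver_meetsDefinable [Countable L.Symbols]
    [Nonempty M] (ha : DenselyIsolatedOver L a) :
    ∃ c : ℕ → M, (∀ k, IsolatedOver L a fun i : Fin k ↦ c i) ∧
      L.MeetsDefinable (Set.range (Sum.elim a c)) := by
  have enum (k : ℕ) (f : Fin k → M) : ∃ E : ℕ → Set M,
      {D | D.Nonempty ∧ (Set.range (Sum.elim a f)).Definable₁ L D} = Set.range E := by
    have hfin : (Set.range (Sum.elim a f)).Countable := Set.countable_range _
    exact ((countable_setOf_definable₁ hfin).mono fun D hD ↦ hD.2).exists_eq_range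
      ⟨Set.univ, Set.univ_nonempty, Set.definable_univ⟩
  choose E hE using enum
  have hE_mem (k : ℕ) (f : Fin k → M) (i : ℕ) :
      (E k f i).Nonempty ∧ (Set.range (Sum.elim a f)).Definable₁ L (E k f i) :=
    (hE k f).symm.subset ⟨i, rfl⟩
  obtain ⟨c, hc⟩ := exists_seq_of_forall_exists_snoc (fun k f ↦ IsolatedOver L a f)
    (fun k f ↦ E k.unpair.2 (f ∘ Fin.castLE (Nat.unpair_right_le k)) k.unpair.1)
    ha.isolatedOver_elim0 fun k f hf ↦ by
      obtain ⟨hne, hdef⟩ := hE_mem _ (f ∘ Fin.castLE (Nat.unpair_right_le k)) k.unpair.1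
      refine hf.exists_mem_snoc ha hne (hdef.mono ?_)
      rintro _ ⟨i | i, rfl⟩
      exacts [⟨Sum.inl i, rfl⟩, ⟨Sum.inr (Fin.castLE (Nat.unpair_right_le k) i), rfl⟩]
  refine ⟨c, fun k ↦ (hc k).1, fun D hD hdef ↦ ?_⟩
  obtain ⟨j, hj⟩ := exists_definable_initial hdef
  obtain ⟨i, rfl⟩ := (hE j _).subset ⟨hD, hj⟩
  have hmem : c (Nat.pair i j) ∈ E _ (fun l ↦ c l) _ := (hc (Nat.pair i j)).2
  rw [Nat.unpair_pair] at hmem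
  exact ⟨_, hmem, Sum.inr _, rfl⟩

theorem SameType.exists_seq_of_isolatedOver {N : Type*} [L.Structure N] {b : Fin n → N}
    (hab : SameType L a b) {c : ℕ → M} (hc : ∀ k, IsolatedOver L a fun i : Fin k ↦ c i) :
    ∃ d : ℕ → N, SameType L (Sum.elim a c) (Sum.elim b d) := by
  obtain ⟨d, hd⟩ := exists_seq_of_forall_exists_snoc (M := N)
    (fun k f ↦ SameType L (Sum.elim a fun i : Fin k ↦ c i) (Sum.elim b f))
    (fun _ _ ↦ Set.univ)
    (by
      convert hab.comp (Sum.elim id Fin.elim0) using 1 <;> ext (i | i) <;>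
        first | rfl | exact i.elim0)
    fun k f hf ↦ by
      obtain ⟨χ, hχ, hχc⟩ := hc (k + 1)
      have hsnoc : (Fin.snoc (fun i : Fin k ↦ c i) (c k) : Fin (k + 1) → M) =
          fun i : Fin (k + 1) ↦ c i :=
        Fin.snoc_init_self fun i : Fin (k + 1) ↦ c i
      obtain ⟨y, hy⟩ :=
        realize_existsLast.1 ((hf _).1 (realize_existsLast.2 ⟨c k, hsnoc ▸ hχc⟩))
      exact ⟨y, trivial, hχ.sameType hab hχc hy⟩
  exact ⟨d, sameType_sumElim_of_forall_initial fun k ↦ (hd k).1⟩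

theorem DenselyIsolatedOver.exists_countable_isPrimeOver [Countable L.Symbols] [Nonempty M]
    (ha : DenselyIsolatedOver L a) :
    ∃ (S : L.ElementarySubstructure M) (a' : Fin n → S), Countable S ∧ (↑) ∘ a' = a ∧
      IsPrimeOver L a' := by
  obtain ⟨c, hc, hmeets⟩ := ha.exists_seq_isolatedOver_meetsDefinable
  let S : L.ElementarySubstructure M := hmeets.toElementarySubstructure
  have hS : (S : Set M) = Set.range (Sum.elim a c) := hmeets.closure_eq_self
  let e : Fin n ⊕ ℕ → S := fun i ↦ ⟨Sum.elim a c i, hS.ge ⟨i, rfl⟩⟩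
  have he : Function.Surjective e := fun x ↦ by
    obtain ⟨i, hi⟩ := hS.le x.2
    exact ⟨i, Subtype.ext hi⟩
  refine ⟨S, e ∘ Sum.inl, he.countable, rfl, fun N _ b hab ↦ ?_⟩
  have type_S : SameType L (Sum.elim a c) e := sameType_comp_elementaryEmbedding S.subtype e
  obtain ⟨d, hd⟩ := ((type_S.comp Sum.inl).trans hab).exists_seq_of_isolatedOver hc
  obtain ⟨f, hf⟩ := (type_S.symm.trans hd).exists_elementaryEmbedding he
  exact ⟨f, fun i ↦ congrFun hf (Sum.inl i)⟩

end Isolated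

section CountableModels

variable {L : FirstOrder.Language.{u, v}} {T : L.Theory}

theorem exists_countable_elementarySubstructure [Countable L.Symbols] {M : Type*}
    [L.Structure M] {s : Set M} (hs : s.Countable) :
    ∃ S : L.ElementarySubstructure M, s ⊆ S ∧ Countable S := by
  have hL : L.card ≤ ℵ₀ := mk_le_aleph0
  rcases finite_or_infinite M with _ | _
  · exact ⟨⊤, fun _ _ ↦ ElementarySubstructure.mem_top _, inferInstance⟩
  · obtain ⟨S, hsS, hS⟩ := exists_elementarySubstructure_card_eq L s (ℵ₀ : Cardinal.{0}) le_rfl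
      (by simpa using hs) (by simpa using hL) (by simp)
    refine ⟨S, hsS, mk_le_aleph0_iff.1 ?_⟩
    simpa using hS.le

theorem exists_countable_modelType_typeOf_eq [Countable L.Symbols] {α : Type*} [Countable α]
    (p : T.CompleteType α) :
    ∃ (M : Theory.ModelType.{u, v, 0} T) (a : α → M), Countable M ∧ T.typeOf a = p := by
  obtain ⟨M, a, rfl⟩ := Theory.exists_modelType_is_realized_in T p
  obtain ⟨S, haS, hS⟩ :=
    exists_countable_elementarySubstructure (L := L) (Set.countable_range a)
  have : Small.{0} S := Countable.toSmall _
  let N : Theory.ModelType.{u, v, 0} T :=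
    Theory.ModelType.equivInduced (M := S.toModel T) (equivShrink S)
  let e : S ≃[L] N := (equivShrink S).inducedStructureEquiv
  let a' : α → S := fun i ↦ ⟨a i, haS ⟨i, rfl⟩⟩
  refine ⟨N, e ∘ a', e.symm.injective.countable, typeOf_eq_typeOf_iff.2 ?_⟩
  exact (sameType_comp_elementaryEmbedding e.toElementaryEmbedding a').trans
    (sameType_comp_elementaryEmbedding S.subtype a').symm

theorem mk_countable_models_le_continuum [Countable L.Symbols] :
    #{c : Quotient (isoSetoid T) | ∃ M, Quotient.mk (isoSetoid T) M = c ∧ Countable M} ≤ 𝔠 := by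
  let C := {c : Quotient (isoSetoid T) | ∃ M, Quotient.mk (isoSetoid T) M = c ∧ Countable M}
  choose M hM hc using fun c : C ↦ c.2
  choose e he using fun c : C ↦ exists_surjective_nat (M c)
  let F : C → Set (L.Formula ℕ) := fun c ↦ {φ | φ.Realize (e c)}
  have hF : Function.Injective F := fun c d hcd ↦ by
    have htype : SameType L (e c) (e d) := Set.ext_iff.1 hcd
    refine Subtype.ext ?_
    rw [← hM c, ← hM d]
    exact Quotient.sound (htype.nonempty_equiv (he c) (he d))
  have hset : #(Set (L.Formula ℕ)) ≤ 𝔠 := by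
    rw [mk_set, ← two_power_aleph0]
    exact power_le_power_left two_ne_zero mk_le_aleph0
  simpa using (lift_mk_le_lift_mk_of_injective hF).trans (lift_le.2 hset)

end CountableModels

section TypeSpace

variable {L : FirstOrder.Language.{u, v}} {T : L.Theory}

instance secondCountableTopology_completeType [Countable L.Symbols] {α : Type*} [Countable α] :
    SecondCountableTopology (T.CompleteType α) := by
  have : Countable L[[α]].Sentence := inferInstanceAs (Countable (L[[α]].Formula Empty))
  exact CompleteType.isTopologicalBasis_range_typesWith.secondCountableTopology
    (Set.countable_range _)

theorem continuum_le_mk_of_isClosed [Countable L.Symbols] {α : Type*} [Countable α]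
    {C : Set (T.CompleteType α)} (hC : IsClosed C) (hunc : ¬ C.Countable) : 𝔠 ≤ #C := by
  let := TopologicalSpace.metrizableSpaceMetric (T.CompleteType α)
  obtain ⟨f, hfC, -, hf⟩ := hC.exists_nat_bool_injection_of_not_countable hunc
  have hinj : Function.Injective (Set.codRestrict f C fun s ↦ hfC ⟨s, rfl⟩) :=
    hf.codRestrict _
  simpa using lift_mk_le_lift_mk_of_injective hinj

end TypeSpace

section UniformChoice

variable {L : FirstOrder.Language.{u, v}} {T : L.Theory} {n m : ℕ}

/-- The formula in `x` stating that if `φ(x, y)` is consistent, then `ψ(x, y)` is consistent,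
implies `φ(x, y)` and decides `θ(x, y)`. -/
noncomputable def choiceFormula (φ ψ θ : L.Formula (Fin n ⊕ Fin m)) : L.Formula (Fin n) :=
  (φ.iExs (Fin m)).imp (ψ.iExs (Fin m) ⊓ ((ψ.imp φ).iAlls (Fin m) ⊓
    ((ψ.imp θ).iAlls (Fin m) ⊔ (ψ.imp θ.not).iAlls (Fin m))))

theorem realize_choiceFormula {M : Type*} [L.Structure M] {φ ψ θ : L.Formula (Fin n ⊕ Fin m)}
    {a : Fin n → M} :
    (choiceFormula φ ψ θ).Realize a ↔ (ConsistentOver a φ → ConsistentOver a ψ ∧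
      ImpliesOver a ψ φ ∧ (ImpliesOver a ψ θ ∨ ImpliesOver a ψ θ.not)) := by
  simp only [choiceFormula, Formula.realize_imp, Formula.realize_inf, Formula.realize_sup,
    Formula.realize_iExs, Formula.realize_iAlls]
  rfl

/-- The set of types for which `ψ` is a correct choice of a principal formula below `φ`. -/
def choiceTypes (T : L.Theory) (φ ψ : L.Formula (Fin n ⊕ Fin m)) :
    Set (T.CompleteType (Fin n)) :=
  ⋂ θ, T.typesWith (Formula.equivSentence (choiceFormula φ ψ θ))

theorem isClosed_choiceTypes (φ ψ : L.Formula (Fin n ⊕ Fin m)) :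
    IsClosed (choiceTypes T φ ψ) :=
  isClosed_iInter fun _ ↦ CompleteType.isClosed_typesWith _

theorem typeOf_mem_choiceTypes_iff {M : Type*} [L.Structure M] [Nonempty M] [M ⊨ T]
    {φ ψ : L.Formula (Fin n ⊕ Fin m)} {a : Fin n → M} :
    T.typeOf a ∈ choiceTypes T φ ψ ↔
      (ConsistentOver a φ → PrincipalOver a ψ ∧ ImpliesOver a ψ φ) := by
  simp only [choiceTypes, Set.mem_iInter, Theory.CompleteType.mem_typesWith_iff,
    Theory.CompleteType.formula_mem_typeOf, realize_choiceFormula]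
  exact ⟨fun h hφ ↦ ⟨⟨(h ⊤ hφ).1, fun θ ↦ (h θ hφ).2.2⟩, (h ⊤ hφ).2.1⟩,
    fun h θ hφ ↦ ⟨(h hφ).1.1, (h hφ).2, (h hφ).1.2 θ⟩⟩

theorem uniformChoice_iff [Countable L.Symbols] {X : Set (T.CompleteType (Fin n))} :
    UniformChoice T X ↔
      ∀ (m : ℕ) (φ : L.Formula (Fin n ⊕ Fin m)), ∃ ψ, X ⊆ choiceTypes T φ ψ := by
  refine forall₂_congr fun m φ ↦ exists_congr fun ψ ↦ ⟨fun h p hp ↦ ?_, fun h p hp M a ha ↦ ?_⟩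
  · obtain ⟨M, a, -, ha⟩ := exists_countable_modelType_typeOf_eq p
    exact ha ▸ typeOf_mem_choiceTypes_iff.2 (h p hp M a ha)
  · exact typeOf_mem_choiceTypes_iff.1 (ha ▸ h hp)

theorem UniformChoice.closure [Countable L.Symbols] {X : Set (T.CompleteType (Fin n))}
    (hX : UniformChoice T X) : UniformChoice T (closure X) := by
  rw [uniformChoice_iff] at hX ⊢
  exact fun m φ ↦ (hX m φ).imp fun ψ hψ ↦ closure_minimal hψ (isClosed_choiceTypes φ ψ)

theorem UniformChoice.exists_isPrimeOver [Countable L.Symbols]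
    {X : Set (T.CompleteType (Fin n))} (hX : UniformChoice T X) {p : T.CompleteType (Fin n)}
    (hp : p ∈ X) :
    ∃ (M : Theory.ModelType.{u, v, 0} T) (a : Fin n → M), Countable M ∧ T.typeOf a = p ∧
      IsPrimeOver L a := by
  obtain ⟨M, a, -, rfl⟩ := exists_countable_modelType_typeOf_eq p
  have ha : DenselyIsolatedOver L a := fun m φ hφ ↦
    (hX m φ).imp fun ψ hψ ↦ hψ _ hp M a rfl hφ
  obtain ⟨S, a', hS, rfl, hprime⟩ := ha.exists_countable_isPrimeOver
  exact ⟨S.toModel T, a', hS,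
    typeOf_eq_typeOf_iff.2 (sameType_comp_elementaryEmbedding S.subtype a').symm, hprime⟩

theorem UniformChoice.exists_countable_cover [Countable L.Symbols]
    {X : Set (T.CompleteType (Fin n))} (hX : UniformChoice T X) :
    ∃ R : primeModels T → Set (T.CompleteType (Fin n)),
      (∀ c, (R c).Countable) ∧ X ⊆ ⋃ c, R c := by
  choose M hM hc _ using fun c : primeModels T ↦ c.2
  refine ⟨fun c ↦ T.realizedTypes (M c) (Fin n), fun c ↦ Set.countable_range _, fun p hp ↦ ?_⟩
  obtain ⟨N, a, hN, rfl, hprime⟩ := hX.exists_isPrimeOver hp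
  let c : primeModels T := ⟨Quotient.mk (isoSetoid T) N, N, rfl, hN, n, a, hprime⟩
  obtain ⟨g⟩ : Nonempty (N ≃[L] M c) := Quotient.exact (hM c).symm
  exact Set.mem_iUnion.2
    ⟨c, realizedTypes_subset_of_elementaryEmbedding g.toElementaryEmbedding ⟨a, rfl⟩⟩

end UniformChoice

end UnsmallTheory

open UnsmallTheory in
theorem proposition5p5_general {L : FirstOrder.Language.{u, v}} [Countable L.Symbols]
    (T : L.Theory) (n : ℕ) (X : Set (T.CompleteType (Fin n))) (hX : ¬ X.Countable)
    (hchoice : UniformChoice T X) : #(primeModels T) = 𝔠 := by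
  refine le_antisymm ?_ ?_
  · refine (mk_le_mk_of_subset ?_).trans (mk_countable_models_le_continuum (T := T))
    rintro c ⟨M, hM, hc, _⟩
    exact ⟨M, hM, hc⟩
  · have hclosure : ¬ (closure X).Countable := fun h ↦ hX (h.mono subset_closure)
    obtain ⟨R, hR, hXR⟩ := hchoice.closure.exists_countable_cover
    exact continuum_le_mk_of_countable_cover
      (continuum_le_mk_of_isClosed isClosed_closure hclosure) hR hXR

theorem proposition5p5 {L : FirstOrder.Language.{u, v}} (T : L.Theory)
    (hT : UnsmallTheory.IsUnsmall T) (n : ℕ) (X : Set (T.CompleteType (Fin n)))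
    (hX : ¬ X.Countable) (hchoice : UnsmallTheory.UniformChoice T X) :
    Cardinal.mk (UnsmallTheory.primeModels T) = Cardinal.continuum := by
  have : Countable L.Symbols := mk_le_aleph0_iff.1 hT.countable
  exact proposition5p5_general T n X hX hchoice
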